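/- A \emph{merge tree} $(T,f)$ is a finite rooted tree $T$ with a function $f:V(T)\to\mathbb{R}\cup\{\infty\}$ such that adjacent vertices have different values, every non-root vertex has exactly one neighbor of higher value, and the root is a degree one node and the only vertex with value $\infty$. Its \emph{leaves} are the non-root vertices of degree one. Let $|T|$ be the associated metric tree, an edge between heights $s$ and $t$ having length $|s-t|$, without the root at infinity; $f$ extends to $|T|$ by interpolation along edges. Write $x\preceq y$ for $x,y\in|T|$ if the path from $x$ to $y$ is (weakly) increasing in $f$, let $\mathrm{LCA}$ (lowest common ancestor) denote the least upper bound in this order, and put $\mathrm{depth}(w)=\sup_{u\preceq w}(f(w)-f(u))$. Two merge trees that differ by subdividing edges are regarded as the same. For merge trees $(T,f),(T',f')$ and $\delta\in\mathbb{R}$, a map $\alpha:|T|\to|T'|$ is \emph{$\delta$-good} if it is continuous and (i) $f'(\alpha(x))-f(x)=\delta$ for all $x\in|T|$; (ii) for every $w\in\mathrm{Im}(\alpha)$, with $x'=\mathrm{LCA}(\alpha^{-1}(w))$, $f(x')-f(u)\le 2\delta$ for all $u\in\alpha^{-1}(w)$; (iii) $\mathrm{depth}(w)\le 2\delta$ for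 every $w\in|T'|\setminus\mathrm{Im}(\alpha)$. The \emph{interleaving distance} is $$d_I((T,f),(T',f'))=\inf\{\delta\mid\text{there is a }\delta\text{-good map }\alpha:|T|\to|T'|\}.$$ A \emph{labeling} of $(T,f)$ with $n$ labels is a map $\pi:\{1,\dots,n\}\to|T|$ whose image contains all leaves (not necessarily injective; labels may lie in the interior of edges, since trees are considered up to subdivision). Its \emph{induced matrix} is $\mathcal{M}(T,f,\pi)_{ij}=f(\mathrm{LCA}(\pi(i),\pi(j)))$, and for labelings $\pi,\pi'$ of $(T,f),(T',f')$ with the same number $n$ of labels the \emph{labeled interleaving distance} is $$d_I^L((T,f,\pi),(T',f',\pi'))=\max_{i,j}\bigl|\mathcal{M}(T,f,\pi)_{ij}-\mathcal{M}(T',f',\pi')_{ij}\bigr|.$$ \textbf{Proposition.} Let $(T,f)$ and $(T',f')$ be merge trees with leaf sets $L$ and $L'$. Then $$d_I((T,f),(T',f'))=\inf_{\pi,\pi'}d_I^L((T,f,\pi),(T',f',\pi')),$$ where the infimum is over all pairs of labelings with a common number $n\le|L|+|L'|$ of labels; both this infimum and the one defining $d_I$ are over nonempty sets of real numbers that are bounded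 below. Moreover: (a) if there is a $\delta$-good map $|T|\to|T'|$, then there are labelings $\pi,\pi'$ with a common number $n\le|L|+|L'|$ of labels such that $d_I^L((T,f,\pi),(T',f',\pi'))\le\delta$; (b) for every $n$ and all labelings $\pi,\pi'$ of $(T,f),(T',f')$ with $n$ labels, with $\delta=d_I^L((T,f,\pi),(T',f',\pi'))$, there is a $\delta$-good map $|T|\to|T'|$. -/

import Mathlib

universe u v

/-- A (finite) merge tree: a finite rooted tree with a height function `f` on its vertices, valued
in `ℝ ∪ {∞}`, such that adjacent vertices have different heights, every non-root vertex has exactly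
one higher neighbour, and the root is a degree one node and the only vertex of height `∞`. -/
structure MergeTree where
  V : Type u
  finite : Finite V
  graph : SimpleGraph V
  isTree : graph.IsTree
  root : V
  f : V → WithTop ℝ
  f_ne_of_adj : ∀ a b, graph.Adj a b → f a ≠ f b
  existsUnique_higher : ∀ a, a ≠ root → ∃! b, graph.Adj a b ∧ f a < f b
  root_degree : (graph.neighborSet root).ncard = 1
  f_eq_top_iff : ∀ a, f a = ⊤ ↔ a = root

namespace MergeTree

/-- The leaves: the non-root vertices of degree one. -/
def leaves (T : MergeTree.{u}) : Set T.V :=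
  {a | a ≠ T.root ∧ (T.graph.neighborSet a).ncard = 1}

/-- `b` is the neighbour of `a` with higher function value. -/
def Up (T : MergeTree.{u}) (a b : T.V) : Prop := T.graph.Adj a b ∧ T.f a < T.f b

/-- `b` is an ancestor of `a` or equal to it: some path from `a` to `b` strictly increases in `f`. -/
def Anc (T : MergeTree.{u}) (a b : T.V) : Prop := Relation.ReflTransGen T.Up a b

/-- The points of finite height of the metric tree `|T|` (that is, all its points except the root).
The edge from a non-root vertex `a` to its higher neighbour `b` is parametrised by height, and
contributes the points `(a, t)` with `f a ≤ t < f b`; in this way every point of the tree, whether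
a vertex or in the interior of an edge, is represented exactly once. -/
@[ext]
structure Point (T : MergeTree.{u}) where
  vertex : T.V
  height : ℝ
  le_height : T.f vertex ≤ (height : WithTop ℝ)
  height_lt : ∀ b, T.Up vertex b → (height : WithTop ℝ) < T.f b

variable {T : MergeTree.{u}}

theorem Up.eq {a b c : T.V} (h : T.Up a b) (h' : T.Up a c) : b = c := by
  have ha : a ≠ T.root := by
    intro ha
    have := (T.f_eq_top_iff a).2 ha
    have h2 := h.2
    rw [this] at h2
    exact not_top_lt h2
  exact (T.existsUnique_higher a ha).unique h h'

theorem Anc.f_le {a b : T.V} (h : T.Anc a b) : T.f a ≤ T.f b := by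
  induction h with
  | refl => exact le_rfl
  | tail _ h ih => exact ih.trans h.2.le

theorem Anc.f_lt {a b : T.V} (h : T.Anc a b) (hne : a ≠ b) : T.f a < T.f b := by
  rcases Relation.ReflTransGen.cases_head h with h | ⟨c, hc, hcb⟩
  · exact absurd h hne
  · exact hc.2.trans_le (Anc.f_le hcb)

theorem Anc.eq_of_f_le {a b : T.V} (h : T.Anc a b) (hf : T.f b ≤ T.f a) : a = b := by
  by_contra hne
  exact absurd (h.f_lt hne) (not_lt.2 hf)

theorem Anc.total {a b c : T.V} (h : T.Anc a b) (h' : T.Anc a c) : T.Anc b c ∨ T.Anc c b :=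
  Relation.ReflTransGen.total_of_right_unique (fun _ _ _ h₁ h₂ => Up.eq h₁ h₂) h h'

theorem anc_root (a : T.V) : T.Anc a T.root := by
  have := T.finite
  have wf : WellFounded (fun a b : T.V => T.f b < T.f a) :=
    @Finite.wellFounded_of_trans_of_irrefl T.V T.finite _
      ⟨fun _ _ _ h₁ h₂ => h₂.trans h₁⟩ ⟨fun _ h => lt_irrefl _ h⟩
  induction a using wf.induction with
  | _ a ih =>
    by_cases ha : a = T.root
    · rw [ha]; exact Relation.ReflTransGen.refl
    · obtain ⟨b, hb, -⟩ := T.existsUnique_higher a ha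
      exact Relation.ReflTransGen.head hb (ih b hb.2)

/-- All non-root vertices have a common non-root ancestor, the neighbour of the root. -/
theorem exists_anc_all (T : MergeTree.{u}) :
    ∃ c, c ≠ T.root ∧ ∀ a, a ≠ T.root → T.Anc a c := by
  obtain ⟨c, hc⟩ := Set.ncard_eq_one.1 T.root_degree
  have hadj : T.graph.Adj T.root c := by
    have : c ∈ T.graph.neighborSet T.root := by rw [hc]; rfl
    exact this
  refine ⟨c, hadj.ne', fun a ha => ?_⟩
  rcases Relation.ReflTransGen.cases_tail (anc_root a) with h | ⟨d, had, hd⟩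
  · exact absurd h.symm ha
  · have : d ∈ T.graph.neighborSet T.root := hd.1.symm
    rw [hc] at this
    rw [Set.mem_singleton_iff.1 this] at had
    exact had

namespace Point

theorem vertex_ne_root (x : T.Point) : x.vertex ≠ T.root := by
  intro h
  have h1 := x.le_height
  rw [(T.f_eq_top_iff _).2 h] at h1
  exact absurd h1 (not_le.2 (WithTop.coe_lt_top _))

theorem height_lt_of_anc (x : T.Point) {a : T.V} (h : T.Anc x.vertex a) (hne : x.vertex ≠ a) :
    (x.height : WithTop ℝ) < T.f a := by
  rcases Relation.ReflTransGen.cases_head h with h | ⟨c, hc, hca⟩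
  · exact absurd h hne
  · exact (x.height_lt c hc).trans_le (Anc.f_le hca)

/-- The ancestor order on the points of the tree: `x ≤ y` if `y` is an ancestor of `x` or equal to
it, that is, if the path from `x` to `y` goes upwards. -/
instance : PartialOrder T.Point where
  le x y := T.Anc x.vertex y.vertex ∧ x.height ≤ y.height
  le_refl _ := ⟨Relation.ReflTransGen.refl, le_rfl⟩
  le_trans _ _ _ h₁ h₂ := ⟨h₁.1.trans h₂.1, h₁.2.trans h₂.2⟩
  le_antisymm _ _ h₁ h₂ :=
    Point.ext (h₁.1.eq_of_f_le h₂.1.f_le) (le_antisymm h₁.2 h₂.2)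

theorem le_def {x y : T.Point} :
    x ≤ y ↔ T.Anc x.vertex y.vertex ∧ x.height ≤ y.height := Iff.rfl

theorem height_mono {x y : T.Point} (h : x ≤ y) : x.height ≤ y.height := h.2

theorem eq_of_le_of_height_le {x y : T.Point} (h : x ≤ y) (hh : y.height ≤ x.height) : x = y := by
  have hv : x.vertex = y.vertex := by
    by_contra hne
    have h1 := (x.height_lt_of_anc h.1 hne).trans_le y.le_height
    exact absurd (WithTop.coe_lt_coe.1 h1) (not_lt.2 hh)
  exact Point.ext hv (le_antisymm h.2 hh)

/-- The ancestors of a point form a chain. -/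
theorem le_total_of_le {x y z : T.Point} (hy : x ≤ y) (hz : x ≤ z) : y ≤ z ∨ z ≤ y := by
  have key : ∀ y z : T.Point, T.Anc y.vertex z.vertex → y ≤ z ∨ z ≤ y := by
    intro y z h
    by_cases hv : y.vertex = z.vertex
    · rcases le_total y.height z.height with hh | hh
      · exact Or.inl ⟨h, hh⟩
      · exact Or.inr ⟨by rw [hv]; exact Relation.ReflTransGen.refl, hh⟩
    · exact Or.inl ⟨h, (WithTop.coe_lt_coe.1
        ((y.height_lt_of_anc h hv).trans_le z.le_height)).le⟩
  rcases hy.1.total hz.1 with h | h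
  · exact key y z h
  · exact (key z y h).symm

theorem exists_isLUB_pair (x y : T.Point) : ∃ z, IsLUB {x, y} z := by
  have := T.finite
  obtain ⟨c, hc, hcanc⟩ := T.exists_anc_all
  obtain ⟨a, ⟨hxa, hya⟩, hmin⟩ := Set.exists_min_image
    {a | T.Anc x.vertex a ∧ T.Anc y.vertex a} T.f (Set.toFinite _)
    ⟨c, hcanc _ x.vertex_ne_root, hcanc _ y.vertex_ne_root⟩
  have hac : T.f a ≠ ⊤ := by
    intro h
    have h1 := hmin c ⟨hcanc _ x.vertex_ne_root, hcanc _ y.vertex_ne_root⟩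
    rw [h, top_le_iff] at h1
    exact hc ((T.f_eq_top_iff c).1 h1)
  obtain ⟨r, hr⟩ := WithTop.ne_top_iff_exists.1 hac
  have hlt : ∀ (p : T.Point) (b : T.V), T.Anc p.vertex a → T.Up a b →
      (p.height : WithTop ℝ) < T.f b := by
    intro p b hpa hb
    by_cases hne : p.vertex = a
    · exact p.height_lt b (by rw [hne]; exact hb)
    · exact (p.height_lt_of_anc hpa hne).trans hb.2
  refine ⟨⟨a, max r (max x.height y.height), ?_, ?_⟩, ?_, ?_⟩
  · rw [← hr]; exact WithTop.coe_le_coe.2 (le_max_left _ _)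
  · intro b hb
    rcases max_choice r (max x.height y.height) with h | h
    · rw [h, hr]; exact hb.2
    · rw [h]
      rcases max_choice x.height y.height with h | h
      · rw [h]; exact hlt x b hxa hb
      · rw [h]; exact hlt y b hya hb
  · rintro p (rfl | rfl)
    · exact ⟨hxa, (le_max_left _ _).trans (le_max_right _ _)⟩
    · exact ⟨hya, (le_max_right _ _).trans (le_max_right _ _)⟩
  · intro z hz
    have hxz : x ≤ z := hz (Or.inl rfl)
    have hyz : y ≤ z := hz (Or.inr rfl)
    have haz : T.f a ≤ T.f z.vertex := hmin _ ⟨hxz.1, hyz.1⟩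
    have hanc : T.Anc a z.vertex := by
      rcases hxa.total hxz.1 with h | h
      · exact h
      · rw [h.eq_of_f_le haz]; exact Relation.ReflTransGen.refl
    refine ⟨hanc, max_le ?_ (max_le hxz.2 hyz.2)⟩
    rw [← hr] at haz
    exact WithTop.coe_le_coe.1 (haz.trans z.le_height)

/-- `x ⊔ y` is the lowest common ancestor of `x` and `y`. -/
noncomputable instance : SemilatticeSup T.Point where
  sup x y := (exists_isLUB_pair x y).choose
  le_sup_left x y := (exists_isLUB_pair x y).choose_spec.1 (Or.inl rfl)
  le_sup_right x y := (exists_isLUB_pair x y).choose_spec.1 (Or.inr rfl)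
  sup_le x y z hx hy := (exists_isLUB_pair x y).choose_spec.2 (by
    rintro p (rfl | rfl)
    · exact hx
    · exact hy)

/-- The length of the unique path from `x` to `y`, which goes up from `x` to the lowest common
ancestor of `x` and `y` and then down to `y`; an edge between heights `s` and `t` has length
`|s - t|`. -/
noncomputable def pathLength (x y : T.Point) : ℝ :=
  ((x ⊔ y).height - x.height) + ((x ⊔ y).height - y.height)

/-- The metric tree: the distance of two points is the length of the path between them. -/
noncomputable instance : MetricSpace T.Point where
  dist := pathLength
  dist_self x := by simp [pathLength]
  dist_comm x y := by simp only [pathLength, sup_comm x y]; ring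
  dist_triangle x y z := by
    simp only [pathLength]
    have h1 := height_mono (le_sup_left : x ≤ x ⊔ y)
    have h2 := height_mono (le_sup_right : y ≤ x ⊔ y)
    have h3 := height_mono (le_sup_left : y ≤ y ⊔ z)
    have h4 := height_mono (le_sup_right : z ≤ y ⊔ z)
    rcases le_total_of_le (le_sup_right : y ≤ x ⊔ y) (le_sup_left : y ≤ y ⊔ z) with h | h
    · have := height_mono (sup_le (le_sup_left.trans h) le_sup_right : x ⊔ z ≤ y ⊔ z)
      linarith
    · have := height_mono (sup_le le_sup_left (le_sup_right.trans h) : x ⊔ z ≤ x ⊔ y)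
      linarith
  eq_of_dist_eq_zero := by
    intro x y h
    simp only [pathLength] at h
    have h1 := height_mono (le_sup_left : x ≤ x ⊔ y)
    have h2 := height_mono (le_sup_right : y ≤ x ⊔ y)
    have hx := eq_of_le_of_height_le (le_sup_left : x ≤ x ⊔ y) (by linarith)
    have hy := eq_of_le_of_height_le (le_sup_right : y ≤ x ⊔ y) (by linarith)
    exact hx.trans hy.symm

/-- The largest height difference between `w` and a point of the subtree rooted at `w`. -/
noncomputable def depth (w : T.Point) : ℝ :=
  sSup {d | ∃ u : T.Point, u ≤ w ∧ d = w.height - u.height}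

/-- The supremum that defines the depth is over a bounded set. -/
theorem depth_bddAbove (w : T.Point) :
    BddAbove {d | ∃ u : T.Point, u ≤ w ∧ d = w.height - u.height} := by
  have := T.finite
  obtain ⟨m, hm⟩ := (Set.toFinite (Set.range fun a : T.V => (T.f a).untopD 0)).bddBelow
  refine ⟨w.height - m, ?_⟩
  rintro _ ⟨p, -, rfl⟩
  have h1 := hm ⟨p.vertex, rfl⟩
  have h2 := p.le_height
  obtain ⟨r, hr⟩ := WithTop.ne_top_iff_exists.1
    (fun h => p.vertex_ne_root ((T.f_eq_top_iff _).1 h))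
  simp only [← hr, WithTop.untopD_coe] at h1
  rw [← hr] at h2
  have := WithTop.coe_le_coe.1 h2
  linarith

end Point

/-- A non-root vertex as a point of the metric tree. -/
def ofVertex (T : MergeTree.{u}) (a : T.V) (ha : a ≠ T.root) : T.Point where
  vertex := a
  height := (T.f a).untop (fun h => ha ((T.f_eq_top_iff a).1 h))
  le_height := by rw [WithTop.coe_untop]
  height_lt b hb := by rw [WithTop.coe_untop]; exact hb.2

/-- `δ`-good maps between merge trees. The lowest common ancestor of a set of points is its least
upper bound in the ancestor order. -/
structure IsGood (T : MergeTree.{u}) (T' : MergeTree.{v}) (δ : ℝ) (α : T.Point → T'.Point) :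
    Prop where
  continuous : Continuous α
  height_sub : ∀ x, (α x).height - x.height = δ
  lca_le : ∀ w ∈ Set.range α, ∃ x', IsLUB (α ⁻¹' {w}) x' ∧
    ∀ p ∈ α ⁻¹' {w}, x'.height - p.height ≤ 2 * δ
  depth_le : ∀ w ∉ Set.range α, w.depth ≤ 2 * δ

/-- The set of all `δ` for which there is a `δ`-good map. -/
def goodSet (T : MergeTree.{u}) (T' : MergeTree.{v}) : Set ℝ :=
  {δ | ∃ α : T.Point → T'.Point, IsGood T T' δ α}

/-- The interleaving distance. -/
noncomputable def interleavingDist (T : MergeTree.{u}) (T' : MergeTree.{v}) : ℝ :=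
  sInf (goodSet T T')

/-- A labeling with `n` labels whose image contains all leaves. Merge trees are considered up to
subdivision of edges, so labels may be put on arbitrary points of the metric tree. -/
structure Labeling (T : MergeTree.{u}) (n : ℕ) where
  toFun : Fin n → T.Point
  surj_leaves : ∀ a (ha : a ∈ T.leaves), T.ofVertex a ha.1 ∈ Set.range toFun

/-- The induced matrix of a labeled merge tree: the heights of the lowest common ancestors. -/
noncomputable def inducedMatrix {n : ℕ} (π : Labeling T n) : Matrix (Fin n) (Fin n) ℝ :=
  Matrix.of fun i j => (π.toFun i ⊔ π.toFun j).height

section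

attribute [local instance] Matrix.normedAddCommGroup

/-- The labeled interleaving distance: the largest absolute value of an entry of the difference of
the induced matrices. -/
noncomputable def labeledInterleavingDist {T : MergeTree.{u}} {T' : MergeTree.{v}} {n : ℕ}
    (π : Labeling T n) (π' : Labeling T' n) : ℝ :=
  ‖inducedMatrix π - inducedMatrix π'‖

end

/-- All labeled interleaving distances for pairs of labelings with a common number of labels, which
is at most the total number of leaves. -/
def labeledDistSet (T : MergeTree.{u}) (T' : MergeTree.{v}) : Set ℝ :=
  {d | ∃ n ≤ T.leaves.ncard + T'.leaves.ncard, ∃ (π : Labeling T n) (π' : Labeling T' n),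
    d = labeledInterleavingDist π π'}

end MergeTree

/-! A point of a merge tree has exactly one ancestor at each greater height, so a height-shifting
monotone map is determined by where it sends the leaves. From a good map `α` to labelings: each leaf
of `T` is paired with its image, and each leaf of `T'` with a chosen preimage of its lowest ancestor
in the image of `α`. Monotonicity of `α` and the bounds on fibres and depths control the two
matrices (`IsGood.monotone`, `IsGood.height_sup_le`, `IsGood.height_least_ancestor_le`). From
labelings to a good map (`exists_isGood`): below `x` there is a label `i`, and `x` goes to the
ancestor of `π' i` that is `δ` higher than `x`; the matrix bound makes this independent of `i`.
Hence labeled distances are themselves good values, every good value dominates a labeled distance,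
and the infima agree. -/

namespace MergeTree

/-! ### Order and metric on the points of a merge tree -/

namespace Point

variable {T : MergeTree.{u}}

theorem le_of_le_of_height_le {x y z : T.Point} (hy : x ≤ y) (hz : x ≤ z)
    (h : y.height ≤ z.height) : y ≤ z := by
  rcases le_total_of_le hy hz with h' | h'
  · exact h'
  · exact (eq_of_le_of_height_le h' h).ge

theorem eq_of_le_of_height_eq {x y z : T.Point} (hy : x ≤ y) (hz : x ≤ z)
    (h : y.height = z.height) : y = z :=
  le_antisymm (le_of_le_of_height_le hy hz h.le) (le_of_le_of_height_le hz hy h.ge)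

theorem exists_ge_height_eq (x : T.Point) {t : ℝ} (ht : x.height ≤ t) :
    ∃ y : T.Point, x ≤ y ∧ y.height = t := by
  have := T.finite
  obtain ⟨a, ⟨hxa, hat⟩, hmax⟩ := Set.exists_max_image
    {a | T.Anc x.vertex a ∧ T.f a ≤ (t : WithTop ℝ)} T.f (Set.toFinite _)
    ⟨x.vertex, Relation.ReflTransGen.refl, x.le_height.trans (WithTop.coe_le_coe.2 ht)⟩
  refine ⟨⟨a, t, hat, fun b hb => ?_⟩, ⟨hxa, ht⟩, rfl⟩
  by_contra hlt
  exact absurd (hmax b ⟨hxa.tail hb, not_lt.1 hlt⟩) (not_le.2 hb.2)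

/-- The ancestor of `x` at height `max x.height t`. -/
noncomputable def lift (x : T.Point) (t : ℝ) : T.Point :=
  (exists_ge_height_eq x (le_max_left x.height t)).choose

theorem le_lift (x : T.Point) (t : ℝ) : x ≤ x.lift t :=
  (exists_ge_height_eq x (le_max_left x.height t)).choose_spec.1

theorem height_lift (x : T.Point) (t : ℝ) : (x.lift t).height = max x.height t :=
  (exists_ge_height_eq x (le_max_left x.height t)).choose_spec.2

theorem height_lift_of_le {x : T.Point} {t : ℝ} (h : x.height ≤ t) : (x.lift t).height = t := by
  rw [height_lift, max_eq_right h]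

theorem lift_height_of_le {x y : T.Point} (h : x ≤ y) : x.lift y.height = y :=
  eq_of_le_of_height_eq (le_lift x _) h (height_lift_of_le h.2)

theorem dist_def (x y : T.Point) :
    dist x y = ((x ⊔ y).height - x.height) + ((x ⊔ y).height - y.height) := rfl

theorem dist_of_le {x y : T.Point} (h : x ≤ y) : dist x y = y.height - x.height := by
  rw [dist_def, sup_eq_right.2 h]; ring

/-- Expresses the order through continuous functions, which makes the sets of ancestors closed. -/
theorem le_iff_dist_eq {x y : T.Point} : x ≤ y ↔ dist x y = y.height - x.height := by
  refine ⟨dist_of_le, fun h => ?_⟩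
  rw [dist_def] at h
  have hy := eq_of_le_of_height_le (le_sup_right : y ≤ x ⊔ y) (by linarith)
  exact sup_eq_right.1 hy.symm

theorem lipschitzWith_height : LipschitzWith 1 (Point.height : T.Point → ℝ) := by
  refine LipschitzWith.of_dist_le_mul fun x y => ?_
  have h1 := height_mono (le_sup_left : x ≤ x ⊔ y)
  have h2 := height_mono (le_sup_right : y ≤ x ⊔ y)
  rw [NNReal.coe_one, one_mul, dist_def, Real.dist_eq, abs_le]
  constructor <;> linarith

theorem continuous_height : Continuous (Point.height : T.Point → ℝ) :=
  lipschitzWith_height.continuous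

theorem isClosed_Ici (x : T.Point) : IsClosed {y : T.Point | x ≤ y} := by
  simp only [le_iff_dist_eq]
  exact isClosed_eq (by fun_prop) (continuous_height.sub continuous_const)

theorem continuous_lift (x : T.Point) : Continuous x.lift := by
  refine (LipschitzWith.of_dist_le_mul (K := 1) fun s t => ?_).continuous
  wlog hst : s ≤ t generalizing s t
  · rw [dist_comm, dist_comm s]
    exact this t s (le_of_not_ge hst)
  have hle : x.lift s ≤ x.lift t := le_of_le_of_height_le (le_lift x s) (le_lift x t) (by
    rw [height_lift, height_lift]; exact max_le_max_left _ hst)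
  rw [dist_of_le hle, height_lift, height_lift, NNReal.coe_one, one_mul, dist_comm, Real.dist_eq]
  have h := abs_max_sub_max_le_abs t s x.height
  rw [max_comm t, max_comm s] at h
  exact (le_abs_self _).trans h

/-- A point has only ancestors among the points of at least its height that are close to it. -/
theorem exists_forall_dist_lt_le (x : T.Point) :
    ∃ ε > 0, ∀ y : T.Point, dist x y < ε → x.height ≤ y.height → x ≤ y := by
  obtain ⟨b, hb, -⟩ := T.existsUnique_higher _ x.vertex_ne_root
  -- `ε` is what remains of the edge above `x`, or 1 if that edge runs to the root at infinity. A
  -- path shorter than `ε` cannot climb off this edge.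
  obtain ⟨ε, hε, hxb⟩ : ∃ ε > 0, ((x.height + ε : ℝ) : WithTop ℝ) ≤ T.f b := by
    have h := x.height_lt b hb
    induction hr : T.f b using WithTop.recTopCoe with
    | top => exact ⟨1, one_pos, le_top⟩
    | coe r =>
      rw [hr, WithTop.coe_lt_coe] at h
      exact ⟨r - x.height, sub_pos.2 h, WithTop.coe_le_coe.2 (by linarith)⟩
  refine ⟨ε, hε, fun y hy hxy => ?_⟩
  have hx : x ≤ x ⊔ y := le_sup_left
  have hy' : y ≤ x ⊔ y := le_sup_right
  rw [dist_def] at hy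
  have h1 := hx.2
  have h2 := hy'.2
  have hv : x.vertex = (x ⊔ y).vertex := by
    rcases Relation.ReflTransGen.cases_head hx.1 with h | ⟨c, hc, hcz⟩
    · exact h
    · rw [hc.eq hb] at hcz
      have := WithTop.coe_le_coe.1 ((hxb.trans (Anc.f_le hcz)).trans (x ⊔ y).le_height)
      linarith
  have hyv : y.vertex = x.vertex := by
    by_contra hne
    have hanc : T.Anc y.vertex x.vertex := by rw [hv]; exact hy'.1
    exact absurd (WithTop.coe_lt_coe.1 ((y.height_lt_of_anc hanc hne).trans_le x.le_height))
      (not_lt.2 hxy)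
  exact ⟨by rw [hyv]; exact Relation.ReflTransGen.refl, hxy⟩

theorem exists_leaf_le (x : T.Point) : ∃ a, ∃ ha : a ∈ T.leaves, T.ofVertex a ha.1 ≤ x := by
  have := T.finite
  obtain ⟨a, hax, hmin⟩ := Set.exists_min_image {a | T.Anc a x.vertex} T.f (Set.toFinite _)
    ⟨x.vertex, Relation.ReflTransGen.refl⟩
  have hle : T.f a ≤ (x.height : WithTop ℝ) := (Anc.f_le hax).trans x.le_height
  have ha : a ≠ T.root := by
    rintro rfl
    rw [(T.f_eq_top_iff _).2 rfl] at hle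
    exact absurd hle (not_le.2 (WithTop.coe_lt_top _))
  obtain ⟨b, hb, hub⟩ := T.existsUnique_higher a ha
  have hleaf : a ∈ T.leaves := by
    refine ⟨ha, Set.ncard_eq_one.2 ⟨b, Set.Subset.antisymm (fun c hc => ?_) ?_⟩⟩
    · refine hub c ⟨hc, lt_of_le_of_ne ?_ (T.f_ne_of_adj _ _ hc)⟩
      by_contra hlt
      exact hlt (hmin c (Relation.ReflTransGen.head ⟨hc.symm, not_le.1 hlt⟩ hax))
    · rintro _ rfl
      exact hb.1
  refine ⟨a, hleaf, hax, WithTop.coe_le_coe.1 ?_⟩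
  simpa only [ofVertex, WithTop.coe_untop] using hle

/-- Fibres of a map that shifts all heights equally lie at a single height, so they are finite and
have least upper bounds. -/
theorem finite_height_eq (t : ℝ) : {x : T.Point | x.height = t}.Finite := by
  have := T.finite
  exact Set.Finite.of_injOn (f := Point.vertex) (t := Set.univ) (fun _ _ => Set.mem_univ _)
    (fun _ hx _ hy h => Point.ext h (Eq.trans hx (Eq.symm hy)))
    Set.finite_univ

instance : Nonempty T.Point := by
  obtain ⟨c, hc, -⟩ := T.exists_anc_all
  exact ⟨T.ofVertex c hc⟩

end Point

open Point

variable {T : MergeTree.{u}} {T' : MergeTree.{v}}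

/-- The leaf `a` as a point of the metric tree. -/
def leafPoint (T : MergeTree.{u}) (a : T.leaves) : T.Point := T.ofVertex a a.2.1

theorem exists_leafPoint_le (x : T.Point) : ∃ a, T.leafPoint a ≤ x :=
  let ⟨a, ha, h⟩ := x.exists_leaf_le
  ⟨⟨a, ha⟩, h⟩

/-! ### Properties of good maps -/

namespace IsGood

variable {δ : ℝ} {α : T.Point → T'.Point}

theorem height_apply (h : IsGood T T' δ α) (x : T.Point) : (α x).height = x.height + δ := by
  have := h.height_sub x
  linarith

theorem nonneg (h : IsGood T T' δ α) : 0 ≤ δ := by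
  obtain ⟨x⟩ : Nonempty T.Point := inferInstance
  obtain ⟨x', hx', hle⟩ := h.lca_le (α x) ⟨x, rfl⟩
  have h1 := height_mono (hx'.1 (show x ∈ α ⁻¹' {α x} from rfl))
  have h2 := hle x rfl
  linarith

/-- Moving up from `x` to `y`, the image stays above `α x`: this condition is closed by continuity,
and it persists slightly further because nearby points that are not lower are ancestors. -/
theorem monotone (h : IsGood T T' δ α) : Monotone α := by
  intro x y hxy
  have hc : Continuous fun t => α (x.lift t) := h.continuous.comp x.continuous_lift
  have hsub : Set.Icc x.height y.height ⊆ {t | α x ≤ α (x.lift t)} := by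
    refine IsClosed.Icc_subset_of_forall_mem_nhdsWithin
      (((isClosed_Ici (α x)).preimage hc).inter isClosed_Icc) ?_ ?_
    · rw [Set.mem_ofPred, lift_height_of_le le_rfl]
    · rintro t ⟨ht, htx, -⟩
      obtain ⟨ε, hε, hloc⟩ := exists_forall_dist_lt_le (α (x.lift t))
      have hball : ∀ᶠ s in nhdsWithin t (Set.Ioi t),
          dist (α (x.lift s)) (α (x.lift t)) < ε :=
        nhdsWithin_le_nhds (hc.continuousAt.eventually (Metric.ball_mem_nhds _ hε))
      filter_upwards [hball, self_mem_nhdsWithin] with s hs hts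
      refine le_trans ht (hloc _ (by rwa [dist_comm]) ?_)
      rw [h.height_apply, h.height_apply, height_lift, height_lift]
      exact add_le_add_left (max_le_max_left _ (le_of_lt hts)) _
  have := hsub ⟨hxy.2, le_rfl⟩
  rwa [Set.mem_ofPred, lift_height_of_le hxy] at this

theorem apply_lift (h : IsGood T T' δ α) {x : T.Point} {w : T'.Point} (hw : α x ≤ w) :
    α (x.lift (w.height - δ)) = w := by
  refine eq_of_le_of_height_eq (h.monotone (x.le_lift _)) hw ?_
  have := height_mono hw
  rw [h.height_apply] at this ⊢
  rw [height_lift_of_le (by linarith)]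
  ring

theorem mem_range_of_le (h : IsGood T T' δ α) {x : T.Point} {w : T'.Point} (hw : α x ≤ w) :
    w ∈ Set.range α :=
  ⟨_, h.apply_lift hw⟩

/-- The ancestors of `x` and `y` at height `w.height - δ` both lie in the fibre over `w`, whose
lowest common ancestor is at most `2 * δ` higher. -/
theorem height_sup_le (h : IsGood T T' δ α) {x y : T.Point} {w : T'.Point} (hx : α x ≤ w)
    (hy : α y ≤ w) : (x ⊔ y).height ≤ w.height + δ := by
  obtain ⟨z, hz, hle⟩ := h.lca_le w (h.mem_range_of_le hx)
  have hxz := (x.le_lift (w.height - δ)).trans (hz.1 (h.apply_lift hx))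
  have hyz := (y.le_lift (w.height - δ)).trans (hz.1 (h.apply_lift hy))
  have h1 := hle _ (h.apply_lift hx)
  have h2 := height_mono hx
  rw [h.height_apply] at h2
  rw [height_lift_of_le (by linarith)] at h1
  have h3 := height_mono (sup_le hxz hyz)
  linarith

/-- Every point of `T'` has a lowest ancestor in the image of a good map. -/
theorem exists_least_ancestor (h : IsGood T T' δ α) (y : T'.Point) :
    ∃ w, IsLeast {v | y ≤ v ∧ v ∈ Set.range α} w := by
  have := T.finite
  obtain ⟨a₀, -⟩ := exists_leafPoint_le (Classical.arbitrary T.Point)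
  -- Every image point above `y` is above some `y ⊔ α (leaf)`. These finitely many joins are
  -- ancestors of `y`, hence a chain.
  obtain ⟨a, -, hmin⟩ := Set.exists_min_image Set.univ
    (fun a => (y ⊔ α (T.leafPoint a)).height) Set.finite_univ ⟨a₀, Set.mem_univ _⟩
  refine ⟨y ⊔ α (T.leafPoint a), ⟨le_sup_left, h.mem_range_of_le le_sup_right⟩, ?_⟩
  rintro _ ⟨hyv, x, rfl⟩
  obtain ⟨b, hb⟩ := exists_leafPoint_le x
  exact (le_of_le_of_height_le le_sup_left le_sup_left (hmin b (Set.mem_univ _))).trans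
    (sup_le hyv (h.monotone hb))

/-- Points from `y` up to but excluding `w` miss the image, so their depth is at most `2 * δ`; let
them approach `w`. -/
theorem height_least_ancestor_le (h : IsGood T T' δ α) {y w : T'.Point}
    (hw : IsLeast {v | y ≤ v ∧ v ∈ Set.range α} w) : w.height ≤ y.height + 2 * δ := by
  refine le_of_forall_lt fun t ht => ?_
  by_contra hlt
  rw [not_lt] at hlt
  obtain ⟨s, hts, hsw⟩ := exists_between ht
  have hyt : y.height ≤ s := by linarith [h.nonneg]
  have hnot : y.lift s ∉ Set.range α := fun hmem => by
    have := height_mono (hw.2 ⟨y.le_lift s, hmem⟩)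
    rw [height_lift_of_le hyt] at this
    linarith
  have h1 := h.depth_le _ hnot
  have h2 : (y.lift s).height - y.height ≤ (y.lift s).depth :=
    le_csSup (y.lift s).depth_bddAbove ⟨y, y.le_lift s, rfl⟩
  rw [height_lift_of_le hyt] at h2
  linarith

end IsGood

/-! ### From good maps to labelings -/

section

attribute [local instance] Matrix.normedAddCommGroup

theorem labeledInterleavingDist_nonneg {n : ℕ} (π : Labeling T n) (π' : Labeling T' n) :
    0 ≤ labeledInterleavingDist π π' :=
  norm_nonneg _

theorem abs_height_sub_le_labeledInterleavingDist {n : ℕ} (π : Labeling T n)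
    (π' : Labeling T' n) (i j : Fin n) :
    |(π.toFun i ⊔ π.toFun j).height - (π'.toFun i ⊔ π'.toFun j).height| ≤
      labeledInterleavingDist π π' :=
  Matrix.norm_entry_le_entrywise_sup_norm (inducedMatrix π - inducedMatrix π') (i := i) (j := j)

theorem labeledInterleavingDist_le {n : ℕ} {π : Labeling T n} {π' : Labeling T' n} {r : ℝ}
    (hr : 0 ≤ r) (h : ∀ i j,
      |(π.toFun i ⊔ π.toFun j).height - (π'.toFun i ⊔ π'.toFun j).height| ≤ r) :
    labeledInterleavingDist π π' ≤ r :=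
  (Matrix.norm_le_iff hr).2 h

end

/-- A labeling by leaves of both trees is given by arbitrary maps on the leaves of the other one. -/
theorem exists_labelings (g : T'.leaves → T.Point) (g' : T.leaves → T'.Point) :
    ∃ (π : Labeling T (T.leaves.ncard + T'.leaves.ncard))
      (π' : Labeling T' (T.leaves.ncard + T'.leaves.ncard)),
      ∀ i, (∃ a, π.toFun i = T.leafPoint a ∧ π'.toFun i = g' a) ∨
        ∃ b, π.toFun i = g b ∧ π'.toFun i = T'.leafPoint b := by
  have := T.finite
  have := T'.finite
  have e : T.leaves ⊕ T'.leaves ≃ Fin (T.leaves.ncard + T'.leaves.ncard) :=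
    (Equiv.sumCongr (Finite.equivFin T.leaves) (Finite.equivFin T'.leaves)).trans finSumFinEquiv
  refine ⟨⟨fun i => Sum.elim T.leafPoint g (e.symm i), fun a ha => ⟨e (.inl ⟨a, ha⟩), ?_⟩⟩,
    ⟨fun i => Sum.elim g' T'.leafPoint (e.symm i), fun b hb => ⟨e (.inr ⟨b, hb⟩), ?_⟩⟩,
    fun i => ?_⟩
  · simp [leafPoint]
  · simp [leafPoint]
  · rcases h : e.symm i with a | b
    · exact .inl ⟨a, by simp [h]⟩
    · exact .inr ⟨b, by simp [h]⟩

theorem IsGood.exists_labelings {δ : ℝ} {α : T.Point → T'.Point} (h : IsGood T T' δ α) :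
    ∃ (π : Labeling T (T.leaves.ncard + T'.leaves.ncard))
      (π' : Labeling T' (T.leaves.ncard + T'.leaves.ncard)),
      labeledInterleavingDist π π' ≤ δ := by
  choose w hw using h.exists_least_ancestor
  have hα : ∀ y, α (Function.invFun α (w y)) = w y := fun y => Function.invFun_eq (hw y).1.2
  obtain ⟨π, π', hπ⟩ := MergeTree.exists_labelings
    (fun b => Function.invFun α (w (T'.leafPoint b))) (fun a => α (T.leafPoint a))
  refine ⟨π, π', labeledInterleavingDist_le h.nonneg fun i j => ?_⟩
  have hwπ : ∀ i, α (π.toFun i) = w (π'.toFun i) ∧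
      (π'.toFun i = α (π.toFun i) ∨ π.toFun i = Function.invFun α (w (π'.toFun i))) := by
    intro i
    rcases hπ i with ⟨a, ha, ha'⟩ | ⟨b, hb, hb'⟩
    · rw [ha, ha']
      exact ⟨le_antisymm (hw _).1.1 ((hw _).2 ⟨le_rfl, _, rfl⟩), .inl rfl⟩
    · rw [hb, hb']
      exact ⟨hα _, .inr rfl⟩
  have hle : ∀ i, π'.toFun i ≤ α (π.toFun i) := fun i => (hwπ i).1 ▸ (hw _).1.1
  have hleast : ∀ i v, π'.toFun i ≤ v → v ∈ Set.range α → α (π.toFun i) ≤ v :=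
    fun i v hv hv' => (hwπ i).1 ▸ (hw _).2 ⟨hv, hv'⟩
  rw [abs_sub_le_iff]
  constructor
  · rw [sub_le_iff_le_add']
    -- If the join misses the image, which is upward closed, neither label is an image point, so
    -- both are leaves of `T'`. They share their lowest ancestor in the image, and since `invFun`
    -- picks the preimage from that ancestor alone, their partners in `T` coincide.
    by_cases hmem : π'.toFun i ⊔ π'.toFun j ∈ Set.range α
    · exact h.height_sup_le (hleast i _ le_sup_left hmem) (hleast j _ le_sup_right hmem)
    · have hup : ∀ k, π'.toFun k ≤ π'.toFun i ⊔ π'.toFun j →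
          π'.toFun i ⊔ π'.toFun j ≤ α (π.toFun k) ∧
          π.toFun k = Function.invFun α (w (π'.toFun k)) := by
        intro k hk
        have hn : ¬ α (π.toFun k) ≤ π'.toFun i ⊔ π'.toFun j := fun h' =>
          hmem (h.mem_range_of_le h')
        refine ⟨(le_total_of_le hk (hle k)).resolve_right hn, (hwπ k).2.resolve_left fun e => ?_⟩
        exact hn (e ▸ hk)
      obtain ⟨hi, hi'⟩ := hup i le_sup_left
      obtain ⟨hj, hj'⟩ := hup j le_sup_right
      have hww : w (π'.toFun i) = w (π'.toFun j) := by
        rw [← (hwπ i).1, ← (hwπ j).1]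
        exact le_antisymm (hleast i _ (le_sup_left.trans hj) ⟨_, rfl⟩)
          (hleast j _ (le_sup_right.trans hi) ⟨_, rfl⟩)
      have hij : π.toFun j = π.toFun i := by rw [hi', hj', hww]
      rw [hij, sup_idem]
      have h1 := h.height_least_ancestor_le (hw (π'.toFun i))
      rw [← (hwπ i).1, h.height_apply] at h1
      have h2 := height_mono (le_sup_left : π'.toFun i ≤ π'.toFun i ⊔ π'.toFun j)
      linarith
  · have h1 := height_mono (sup_le ((hle i).trans (h.monotone le_sup_left))
      ((hle j).trans (h.monotone le_sup_right)) :
        π'.toFun i ⊔ π'.toFun j ≤ α (π.toFun i ⊔ π.toFun j))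
    rw [h.height_apply] at h1
    linarith

theorem Labeling.exists_le {n : ℕ} (π : Labeling T n) (x : T.Point) : ∃ i, π.toFun i ≤ x := by
  obtain ⟨a, ha, hx⟩ := x.exists_leaf_le
  obtain ⟨i, hi⟩ := π.surj_leaves a ha
  exact ⟨i, hi ▸ hx⟩

/-! ### From labelings to good maps -/

theorem exists_isLUB_of_finite {s : Set T.Point} (hs : s.Finite) (hne : s.Nonempty) :
    ∃ x, IsLUB s x := by
  have h := Finset.isLUB_sup' (hs.toFinset_nonempty.2 hne)
  rw [hs.coe_toFinset] at h
  exact ⟨_, h⟩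

theorem exists_isGood {n : ℕ} (π : Labeling T n) (π' : Labeling T' n) :
    ∃ α : T.Point → T'.Point, IsGood T T' (labeledInterleavingDist π π') α := by
  have hM := abs_height_sub_le_labeledInterleavingDist π π'
  have hδ := labeledInterleavingDist_nonneg π π'
  generalize labeledInterleavingDist π π' = δ at hM hδ
  simp only [abs_sub_le_iff] at hM
  -- Diagonal entries are the heights of the labels.
  have hM1 : ∀ i, (π'.toFun i).height ≤ (π.toFun i).height + δ := fun i => by
    have := (hM i i).2
    simp only [sup_idem] at this
    linarith
  have hM2 : ∀ i, (π.toFun i).height ≤ (π'.toFun i).height + δ := fun i => by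
    have := (hM i i).1
    simp only [sup_idem] at this
    linarith
  choose ι hι using π.exists_le
  let α : T.Point → T'.Point := fun x => (π'.toFun (ι x)).lift (x.height + δ)
  have hheight : ∀ x, (α x).height = x.height + δ := fun x =>
    height_lift_of_le ((hM1 _).trans (by linarith [height_mono (hι x)]))
  -- Independence of the choice `ι x`: labels `i` and `ι x` join at or below `x`, so their partners
  -- join at height at most `x.height + δ`, hence at or below `α x`.
  have hle : ∀ x i, π.toFun i ≤ x → π'.toFun i ≤ α x := by
    intro x i hi
    have h1 : π'.toFun (ι x) ≤ α x := le_lift _ _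
    refine le_trans le_sup_left
      (le_of_le_of_height_le (le_sup_right : _ ≤ π'.toFun i ⊔ π'.toFun (ι x)) h1 ?_)
    rw [hheight]
    have h2 := (hM i (ι x)).2
    have h3 := height_mono (sup_le hi (hι x))
    linarith
  have hmono : Monotone α := fun x y hxy =>
    le_of_le_of_height_le (hle x _ (hι x)) (hle y _ ((hι x).trans hxy)) (by
      rw [hheight, hheight]
      linarith [height_mono hxy])
  refine ⟨α, ?_, fun x => by rw [hheight]; ring, ?_, ?_⟩
  · refine (LipschitzWith.of_dist_le_mul (K := 1) fun x y => ?_).continuous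
    have h1 := height_mono (sup_le (hmono le_sup_left) (hmono le_sup_right) :
      α x ⊔ α y ≤ α (x ⊔ y))
    rw [NNReal.coe_one, one_mul, dist_def, dist_def, hheight, hheight]
    rw [hheight] at h1
    linarith
  · rintro _ ⟨p, rfl⟩
    have hfib : ∀ q ∈ α ⁻¹' {α p}, q.height = p.height := fun q hq => by
      have h1 : (α q).height = (α p).height := congrArg Point.height hq
      rw [hheight, hheight] at h1
      linarith
    obtain ⟨z, hz⟩ := exists_isLUB_of_finite ((finite_height_eq p.height).subset hfib) ⟨p, rfl⟩
    refine ⟨z, hz, fun q hq => ?_⟩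
    have hP : (p.lift (p.height + 2 * δ)).height = p.height + 2 * δ :=
      height_lift_of_le (by linarith)
    -- For `r` in the fibre, the partners of the labels below `r` and `p` join at or below `α p`.
    -- The labels thus join at height at most `p.height + 2 * δ`, that is `δ` from the shift and `δ`
    -- from the matrices.
    have hup : z ≤ p.lift (p.height + 2 * δ) := hz.2 fun r hr => by
      have h1 : (π'.toFun (ι r) ⊔ π'.toFun (ι p)).height ≤ (α p).height :=
        height_mono (sup_le ((hle r _ (hι r)).trans_eq hr) (hle p _ (hι p)))
      have h2 := (hM (ι r) (ι p)).1
      rw [hheight] at h1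
      have h3 : π.toFun (ι r) ⊔ π.toFun (ι p) ≤ p.lift (p.height + 2 * δ) :=
        le_of_le_of_height_le le_sup_right ((hι p).trans (le_lift _ _)) (by rw [hP]; linarith)
      refine le_of_le_of_height_le (hι r) (le_sup_left.trans h3) ?_
      rw [hP, hfib r hr]
      linarith
    have := height_mono hup
    rw [hfib q hq]
    linarith
  · intro w hw
    refine Real.sSup_le ?_ (by linarith)
    rintro _ ⟨u, hu, rfl⟩
    -- If `u` were more than `2 * δ` below `w`, the partner in `T` of a label below `u` would be
    -- lower than `w.height - δ`, and its ancestor at that height would map to `w`.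
    obtain ⟨i, hi⟩ := π'.exists_le u
    by_contra hlt
    rw [not_le] at hlt
    have h1 := height_mono hi
    have h2 := hM2 i
    have hx : ((π.toFun i).lift (w.height - δ)).height = w.height - δ :=
      height_lift_of_le (by linarith)
    refine hw ⟨(π.toFun i).lift (w.height - δ), eq_of_le_of_height_eq
      (hle _ i (le_lift _ _)) (hi.trans hu) ?_⟩
    rw [hheight, hx]
    ring

/-! ### Comparison of the infima -/

theorem labeledDistSet_nonempty : (labeledDistSet T T').Nonempty := by
  obtain ⟨π, π', -⟩ := exists_labelings (T := T) (T' := T')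
    (fun _ => Classical.arbitrary _) (fun _ => Classical.arbitrary _)
  exact ⟨_, _, le_rfl, π, π', rfl⟩

theorem labeledDistSet_subset_goodSet : labeledDistSet T T' ⊆ goodSet T T' := by
  rintro _ ⟨n, -, π, π', rfl⟩
  exact exists_isGood π π'

theorem lowerBounds_labeledDistSet :
    lowerBounds (labeledDistSet T T') = lowerBounds (goodSet T T') := by
  refine Set.Subset.antisymm ?_ (lowerBounds_mono_set labeledDistSet_subset_goodSet)
  rintro r hr δ ⟨α, hα⟩
  obtain ⟨π, π', hπ⟩ := hα.exists_labelings
  exact (hr ⟨_, le_rfl, π, π', rfl⟩).trans hπ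

theorem isGLB_goodSet : IsGLB (goodSet T T') (interleavingDist T T') :=
  isGLB_csInf (labeledDistSet_nonempty.mono labeledDistSet_subset_goodSet)
    ⟨0, fun _ ⟨_, h⟩ => h.nonneg⟩

theorem isGLB_labeledDistSet : IsGLB (labeledDistSet T T') (interleavingDist T T') := by
  rw [IsGLB, lowerBounds_labeledDistSet]
  exact isGLB_goodSet

end MergeTree

theorem mainTheorem2 (T : MergeTree.{u}) (T' : MergeTree.{v}) :
    -- the two infima are over nonempty sets of reals that are bounded below, and they agree
    (IsGLB (MergeTree.goodSet T T') (MergeTree.interleavingDist T T') ∧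
      IsGLB (MergeTree.labeledDistSet T T') (MergeTree.interleavingDist T T') ∧
      MergeTree.interleavingDist T T' = sInf (MergeTree.labeledDistSet T T')) ∧
    -- from good maps to labelings
    (∀ (δ : ℝ) (α : T.Point → T'.Point), MergeTree.IsGood T T' δ α →
      ∃ n ≤ T.leaves.ncard + T'.leaves.ncard,
        ∃ (π : MergeTree.Labeling T n) (π' : MergeTree.Labeling T' n),
          MergeTree.labeledInterleavingDist π π' ≤ δ) ∧
    -- from labelings to good maps
    (∀ (n : ℕ) (π : MergeTree.Labeling T n) (π' : MergeTree.Labeling T' n),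
      ∃ α : T.Point → T'.Point,
        MergeTree.IsGood T T' (MergeTree.labeledInterleavingDist π π') α) := by
  refine ⟨⟨MergeTree.isGLB_goodSet, MergeTree.isGLB_labeledDistSet,
    (MergeTree.isGLB_labeledDistSet.csInf_eq MergeTree.labeledDistSet_nonempty).symm⟩, ?_, ?_⟩
  · intro δ α h
    exact ⟨_, le_rfl, h.exists_labelings⟩
  · intro n π π'
    exact MergeTree.exists_isGood π π'
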